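/- Let $\mathbb N=\{0,1,2,\dots\}$. For sequences $u,v$ of real numbers, $u(n)=\Theta(v(n))$ means that there are constants $c,C>0$ with $c\,|v(n)|\le |u(n)|\le C\,|v(n)|$ for all sufficiently large $n$ (so $u(n)=\Theta(0)$ means that $u$ is eventually zero). For a square matrix $M$ with entries in $\mathbb N$, $\mathrm{Spec}(M)$ denotes the multiset of its complex eigenvalues, counted with algebraic multiplicity, and $\mathsf p(M)$ denotes the least positive integer $p$ for which there is a permutation matrix $T$ such that $T^{-1}M^pT$ is upper or lower block triangular with each diagonal square block either primitive (some positive power has only positive entries) or equal to the $1\times 1$ zero matrix. (1) Let $M\in\mathbb N^{m\times m}$. (i) For every $i\in\{1,\dots,m\}$ there exist a real number $\lambda\ge 0$ with $\lambda\in\mathrm{Spec}(M)$ and an integer $d\in\mathbb N$ such that $$\sum_{j=1}^m (M^n)_{i,j}=\Theta(n^d\lambda^n).$$ In particular there is no dependence on $n$ modulo $\mathsf p(M)$: with the same $\lambda$ and $d$, for every $r\in\{0,\dots,\mathsf p(M)-1\}$, $$\sum_{j=1}^m (M^{\mathsf p(M)n+r})_{i,j}=\Theta\bigl(n^d(\lambda^{\mathsf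 p(M)})^n\bigr).$$ (ii) For every $j\in\{1,\dots,m\}$ there exist a real number $\lambda\ge 0$ with $\lambda\in\mathrm{Spec}(M)$ and an integer $d\in\mathbb N$ such that $$\sum_{i=1}^m (M^n)_{i,j}=\Theta(n^d\lambda^n),$$ and, with the same $\lambda$ and $d$, for every $r\in\{0,\dots,\mathsf p(M)-1\}$, $$\sum_{i=1}^m (M^{\mathsf p(M)n+r})_{i,j}=\Theta\bigl(n^d(\lambda^{\mathsf p(M)})^n\bigr).$$ (2) Let $A$ be a finite alphabet and let $f\colon A^*\to A^*$ be a morphism of the free monoid on $A$ (images of letters may be empty). Let $\mathrm{Spec}(f)=\mathrm{Spec}(\mathsf{Mat}_f)$, where $\mathsf{Mat}_f\in\mathbb N^{A\times A}$ is the incidence matrix of $f$: $(\mathsf{Mat}_f)_{a,b}$ is the number of occurrences of the letter $a$ in the word $f(b)$. Then for every letter $a\in A$ there exist a real number $\lambda\ge 0$ with $\lambda\in\mathrm{Spec}(f)$ and an integer $d\in\mathbb N$ such that the length of the word $f^n(a)$ satisfies $$|f^n(a)|=\Theta(n^d\lambda^n).$$ -/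

import Mathlib

open Filter Asymptotics

/-- The spectrum of a square matrix with natural entries: the multiset of its complex eigenvalues,
repeated according to algebraic multiplicity. -/
noncomputable def matSpec {ι : Type*} [Fintype ι] [DecidableEq ι] (M : Matrix ι ι ℕ) :
    Multiset ℂ :=
  (M.map (fun x : ℕ => (x : ℂ))).charpoly.roots

/-- For some simultaneous reordering `σ` of rows and columns (that is, after conjugation by a
permutation matrix), the real matrix `M` is upper or lower block triangular, and each of its
diagonal square blocks is primitive or is the `1 × 1` zero matrix. The blocks are the fibres of
the monotone map `b`. -/
def IsPrimitiveBlockTriangular {m : ℕ} (M : Matrix (Fin m) (Fin m) ℝ) : Prop :=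
  ∃ (σ : Equiv.Perm (Fin m)) (b : Fin m → Fin m), Monotone b ∧
    ((M.submatrix σ σ).BlockTriangular b ∨ (M.submatrix σ σ).transpose.BlockTriangular b) ∧
    ∀ k ∈ Set.range b,
      ((M.submatrix σ σ).toSquareBlock b k).IsPrimitive ∨
        (Fintype.card {i // b i = k} = 1 ∧ (M.submatrix σ σ).toSquareBlock b k = 0)

/-- `𝗉(M)`: the least positive integer `p` such that `M ^ p` is, up to a permutation, block
triangular with diagonal blocks that are primitive or `(0)`. -/
noncomputable def matPeriod {m : ℕ} (M : Matrix (Fin m) (Fin m) ℕ) : ℕ :=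
  sInf {p : ℕ | 0 < p ∧ IsPrimitiveBlockTriangular ((M.map (fun x : ℕ => (x : ℝ))) ^ p)}

/-- The incidence matrix of a morphism `f : A* → A*`: the entry `(a, b)` is the number of
occurrences of the letter `a` in the word `f(b)`. -/
def incidenceMatrix {A : Type*} [DecidableEq A] (f : FreeMonoid A →* FreeMonoid A) :
    Matrix A A ℕ :=
  fun a b => (FreeMonoid.toList (f (FreeMonoid.of b))).count a

/-- The spectrum of a morphism is the spectrum of its incidence matrix. -/
noncomputable def morphismSpec {A : Type*} [Fintype A] [DecidableEq A]
    (f : FreeMonoid A →* FreeMonoid A) : Multiset ℂ :=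
  matSpec (incidenceMatrix f)

/-! Let `v j n` be the `j`-th row sum of `M ^ n`. Reachability along nonzero entries orders the
strongly connected components, and the proof inducts on the number of indices reachable from `i`.
The component of `i` has a positive left Perron vector `y`, with eigenvalue `ρ`. Pairing the row
sums with `y` gives a scalar `s n = ∑ c, y c * v c n` satisfying `s (n + 1) = ρ * s n + w n`, where
`w` is a nonnegative combination of row sums from strictly lower components, of known order by
induction. Such recurrences preserve the scale `n ^ d * lam ^ n` (`HasGrowth.of_recurrence`): the
larger of `ρ` and the rate of `w` wins, and a tie at a positive rate raises the degree by one.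

Row sums within one component are comparable (`Matrix.Reaches.isBigO_rowSum`), so `s` has the order
of `v i`. Perron vectors need irreducibility only, not primitivity; hence no dependence on residues
of `n`. Columns follow by transposition, and word lengths are column sums for the incidence matrix.
-/

/-- The sequence `u` is of order `n ^ d * lam ^ n` for some `lam ≥ 0` in `S ∪ {0}` and some `d`. -/
def HasGrowth (S : Set ℝ) (u : ℕ → ℝ) : Prop :=
  ∃ (lam : ℝ) (d : ℕ), 0 ≤ lam ∧ (lam = 0 ∨ lam ∈ S) ∧
    u =Θ[atTop] fun n : ℕ => (n : ℝ) ^ d * lam ^ n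

/-! ### Comparison of polynomial-exponential orders -/

theorem pow_mul_zero_pow_eventuallyEq (d : ℕ) :
    (fun n : ℕ => (n : ℝ) ^ d * (0 : ℝ) ^ n) =ᶠ[atTop] 0 := by
  filter_upwards [eventually_gt_atTop 0] with n hn
  simp [zero_pow hn.ne']

theorem isBigO_pow_mul_pow_of_lt {a b : ℝ} (ha : 0 ≤ a) (hab : a < b) (d e : ℕ) :
    (fun n : ℕ => (n : ℝ) ^ d * a ^ n) =O[atTop] fun n : ℕ => (n : ℝ) ^ e * b ^ n := by
  refine (isLittleO_pow_const_mul_const_pow_const_pow_of_norm_lt d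
    (by rwa [Real.norm_of_nonneg ha])).isBigO.trans (IsBigO.of_bound 1 ?_)
  filter_upwards [eventually_ge_atTop 1] with n hn
  have h1 : (1 : ℝ) ≤ (n : ℝ) ^ e := one_le_pow₀ (by exact_mod_cast hn)
  have hb : 0 ≤ b ^ n := pow_nonneg (ha.trans hab.le) n
  rw [Real.norm_of_nonneg hb, Real.norm_of_nonneg (by positivity), one_mul]
  exact le_mul_of_one_le_left hb h1

theorem isBigO_pow_mul_pow_of_le (a : ℝ) {d e : ℕ} (hde : d ≤ e) :
    (fun n : ℕ => (n : ℝ) ^ d * a ^ n) =O[atTop] fun n : ℕ => (n : ℝ) ^ e * a ^ n := by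
  refine IsBigO.of_bound 1 ?_
  filter_upwards [eventually_ge_atTop 1] with n hn
  rw [norm_mul, norm_mul, one_mul]
  gcongr ?_ * _
  rw [Real.norm_of_nonneg (by positivity), Real.norm_of_nonneg (by positivity)]
  exact pow_le_pow_right₀ (by exact_mod_cast hn) hde

theorem isBigO_pow_mul_pow_total {a b : ℝ} (ha : 0 ≤ a) (hb : 0 ≤ b) (d e : ℕ) :
    ((fun n : ℕ => (n : ℝ) ^ d * a ^ n) =O[atTop] fun n : ℕ => (n : ℝ) ^ e * b ^ n) ∨
      (fun n : ℕ => (n : ℝ) ^ e * b ^ n) =O[atTop] fun n : ℕ => (n : ℝ) ^ d * a ^ n := by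
  rcases lt_trichotomy a b with h | rfl | h
  · exact .inl (isBigO_pow_mul_pow_of_lt ha h d e)
  · exact (le_total d e).imp (isBigO_pow_mul_pow_of_le a) (isBigO_pow_mul_pow_of_le a)
  · exact .inr (isBigO_pow_mul_pow_of_lt hb h e d)

theorem isTheta_add_of_isBigO {u v : ℕ → ℝ} (hu : 0 ≤ u) (hv : 0 ≤ v) (h : v =O[atTop] u) :
    (fun n => u n + v n) =Θ[atTop] u := by
  refine ⟨(isBigO_refl u _).add h, IsBigO.of_bound 1 (Eventually.of_forall fun n => ?_)⟩
  have h1 := hu n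
  have h2 := hv n
  simp only [Pi.zero_apply] at h1 h2
  rw [Real.norm_of_nonneg h1, Real.norm_of_nonneg (add_nonneg h1 h2)]
  linarith

namespace HasGrowth

variable {S : Set ℝ} {u v : ℕ → ℝ}

theorem zero : HasGrowth S fun _ => 0 :=
  ⟨0, 0, le_rfl, .inl rfl, (pow_mul_zero_pow_eventuallyEq 0).symm.isTheta⟩

theorem congr_isTheta (hu : HasGrowth S u) (h : v =Θ[atTop] u) : HasGrowth S v := by
  obtain ⟨a, d, ha, haS, hu⟩ := hu
  exact ⟨a, d, ha, haS, h.trans hu⟩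

/-- Any two orders on the scale are comparable, and nonnegative terms cannot cancel, so the larger
order prevails. -/
theorem add (hu : HasGrowth S u) (hv : HasGrowth S v) (hu0 : 0 ≤ u) (hv0 : 0 ≤ v) :
    HasGrowth S fun n => u n + v n := by
  have key : v =O[atTop] u ∨ u =O[atTop] v := by
    obtain ⟨a, d, ha, -, hu⟩ := hu
    obtain ⟨b, e, hb, -, hv⟩ := hv
    rcases isBigO_pow_mul_pow_total hb ha e d with h | h
    · exact .inl ((hv.isBigO.trans h).trans hu.symm.isBigO)
    · exact .inr ((hu.isBigO.trans h).trans hv.symm.isBigO)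
  rcases key with h | h
  · exact hu.congr_isTheta (isTheta_add_of_isBigO hu0 hv0 h)
  · simp only [add_comm (u _)]
    exact hv.congr_isTheta (isTheta_add_of_isBigO hv0 hu0 h)

theorem const_mul (hu : HasGrowth S u) (c : ℝ) : HasGrowth S fun n => c * u n := by
  rcases eq_or_ne c 0 with rfl | hc
  · simpa using zero
  · exact hu.congr_isTheta ((isTheta_const_mul_left hc).2 (isTheta_refl u _))

theorem sum {ι : Type*} (t : Finset ι) (f : ι → ℕ → ℝ) (h0 : ∀ i ∈ t, 0 ≤ f i)
    (h : ∀ i ∈ t, HasGrowth S (f i)) : HasGrowth S fun n => ∑ i ∈ t, f i n := by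
  classical
  induction t using Finset.induction_on with
  | empty => simpa using zero
  | insert i t hi ih =>
    simp only [Finset.sum_insert hi]
    refine (h i (by simp)).add (ih (fun j hj => h0 j (by simp [hj])) fun j hj => h j (by simp [hj]))
      (h0 i (by simp)) fun n => Finset.sum_nonneg fun j hj => h0 j (by simp [hj]) n

end HasGrowth

/-! ### First-order linear recurrences -/

variable {w s : ℕ → ℝ}

/-- A supersolution of a first-order linear recurrence bounds its solution from above. -/
theorem le_of_supersolution {a : ℝ} (ha : 0 ≤ a) {g : ℕ → ℝ} {N : ℕ}
    (hs : ∀ n, s (n + 1) = a * s n + w n) (h0 : s N ≤ g N)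
    (hg : ∀ n ≥ N, a * g n + w n ≤ g (n + 1)) : ∀ n ≥ N, s n ≤ g n := by
  intro n hn
  induction n, hn using Nat.le_induction with
  | base => exact h0
  | succ n hn ih =>
    have := mul_le_mul_of_nonneg_left ih ha
    linarith [hs n, hg n hn]

/-- A subsolution of a first-order linear recurrence bounds its solution from below. -/
theorem ge_of_subsolution {a : ℝ} (ha : 0 ≤ a) {g : ℕ → ℝ} {N : ℕ}
    (hs : ∀ n, s (n + 1) = a * s n + w n) (h0 : g N ≤ s N)
    (hg : ∀ n ≥ N, g (n + 1) ≤ a * g n + w n) : ∀ n ≥ N, g n ≤ s n := by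
  intro n hn
  induction n, hn using Nat.le_induction with
  | base => exact h0
  | succ n hn ih =>
    have := mul_le_mul_of_nonneg_left ih ha
    linarith [hs n, hg n hn]

/-- The threshold is positive so that `N ^ d * b ^ N` can later be a divisor. -/
theorem exists_upper_bound {g : ℕ → ℝ} (hg : 0 ≤ g) (h : w =O[atTop] g) :
    ∃ C > 0, ∃ N > 0, ∀ n ≥ N, w n ≤ C * g n := by
  obtain ⟨C, hC, h⟩ := h.exists_pos
  obtain ⟨N, hN⟩ := eventually_atTop.1 h.bound
  refine ⟨C, hC, N + 1, by omega, fun n hn => ?_⟩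
  have := hN n (by omega)
  rw [Real.norm_of_nonneg (hg n)] at this
  exact (le_abs_self _).trans this

theorem exists_lower_bound {g : ℕ → ℝ} (hw : 0 ≤ w) (h : g =O[atTop] w) :
    ∃ c > 0, ∃ N > 0, ∀ n ≥ N, c * g n ≤ w n := by
  obtain ⟨C, hC, N, hN, h⟩ := exists_upper_bound hw h
  refine ⟨C⁻¹, inv_pos.2 hC, N, hN, fun n hn => ?_⟩
  rw [inv_mul_le_iff₀ hC]
  exact h n hn

theorem isBigO_of_le {g : ℕ → ℝ} (hs : 0 ≤ s) {C : ℝ} {N : ℕ}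
    (h : ∀ n ≥ N, s n ≤ C * g n) : s =O[atTop] g := by
  refine IsBigO.of_bound |C| ?_
  filter_upwards [eventually_ge_atTop N] with n hn
  rw [Real.norm_of_nonneg (hs n), Real.norm_eq_abs, ← abs_mul]
  exact (h n hn).trans (le_abs_self _)

/-- The forcing term dominates: `K * n ^ d * b ^ n` is a supersolution once `K * (b - a) ≥ C`, and
`s (k + 1) ≥ w k` gives the lower bound. -/
theorem isTheta_of_recurrence_of_lt {a b : ℝ} {d : ℕ} (ha : 0 ≤ a) (hab : a < b)
    (hs0 : 0 ≤ s) (hw0 : 0 ≤ w) (hs : ∀ n, s (n + 1) = a * s n + w n)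
    (hw : w =Θ[atTop] fun n : ℕ => (n : ℝ) ^ d * b ^ n) :
    s =Θ[atTop] fun n : ℕ => (n : ℝ) ^ d * b ^ n := by
  have hb : 0 < b := ha.trans_lt hab
  have hg : (0 : ℕ → ℝ) ≤ fun n : ℕ => (n : ℝ) ^ d * b ^ n := fun n => by
    simp only [Pi.zero_apply]; positivity
  obtain ⟨C, hC, N, hN, hup⟩ := exists_upper_bound hg hw.isBigO
  obtain ⟨c, hc, N', hN', hlo⟩ := exists_lower_bound hw0 hw.symm.isBigO
  constructor
  · have hgN : (0 : ℝ) < (N : ℝ) ^ d * b ^ N := by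
      have : (0 : ℝ) < N := by exact_mod_cast hN
      positivity
    set K := max (C / (b - a)) (s N / ((N : ℝ) ^ d * b ^ N)) with hK
    have hK1 : C ≤ K * (b - a) := (div_le_iff₀ (by linarith)).1 (le_max_left _ _)
    have hK0 : 0 < K := (div_pos hC (by linarith)).trans_le (le_max_left _ _)
    refine isBigO_of_le hs0 (C := K) (le_of_supersolution ha hs
      ((div_le_iff₀ hgN).1 (le_max_right _ _)) fun n hn => ?_)
    have h1 := hup n hn
    have h2 : (n : ℝ) ^ d ≤ ((n + 1 : ℕ) : ℝ) ^ d := by gcongr; simp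
    calc a * (K * ((n : ℝ) ^ d * b ^ n)) + w n
        ≤ a * (K * ((n : ℝ) ^ d * b ^ n)) + K * (b - a) * ((n : ℝ) ^ d * b ^ n) := by
          have := mul_le_mul_of_nonneg_right hK1 (hg n)
          linarith
      _ = K * ((n : ℝ) ^ d * b ^ (n + 1)) := by ring
      _ ≤ K * (((n + 1 : ℕ) : ℝ) ^ d * b ^ (n + 1)) := by gcongr
  · refine isBigO_of_le hg (C := 2 ^ d * b * c⁻¹) (N := N' + 1) fun n hn => ?_
    obtain ⟨k, rfl⟩ : ∃ k, n = k + 1 := ⟨n - 1, by omega⟩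
    have h1 := hlo k (by omega)
    have h2 : w k ≤ s (k + 1) := by
      rw [hs]
      linarith [mul_nonneg ha (hs0 k)]
    have hk : (1 : ℝ) ≤ k := by exact_mod_cast (by omega : 1 ≤ k)
    have h3 : ((k + 1 : ℕ) : ℝ) ^ d ≤ 2 ^ d * (k : ℝ) ^ d := by
      rw [← mul_pow]
      gcongr
      push_cast
      linarith
    calc ((k + 1 : ℕ) : ℝ) ^ d * b ^ (k + 1) ≤ (2 ^ d * (k : ℝ) ^ d) * b ^ (k + 1) := by gcongr
      _ = 2 ^ d * b * c⁻¹ * (c * ((k : ℝ) ^ d * b ^ k)) := by field_simp; ring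
      _ ≤ 2 ^ d * b * c⁻¹ * s (k + 1) := by
        have : 0 < 2 ^ d * b * c⁻¹ := by positivity
        exact mul_le_mul_of_nonneg_left (h1.trans h2) this.le

/-- Resonance: the increment of `n ^ (d + 1)` has order `n ^ d`, so multiples of `n ^ (d + 1) * a ^
n` serve as super- and subsolutions. -/
theorem isTheta_of_recurrence_of_eq {a : ℝ} {d : ℕ} (ha : 0 < a)
    (hs0 : ∀ n, 0 < s n) (hw0 : 0 ≤ w) (hs : ∀ n, s (n + 1) = a * s n + w n)
    (hw : w =Θ[atTop] fun n : ℕ => (n : ℝ) ^ d * a ^ n) :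
    s =Θ[atTop] fun n : ℕ => (n : ℝ) ^ (d + 1) * a ^ n := by
  have hg : ∀ e, (0 : ℕ → ℝ) ≤ fun n : ℕ => (n : ℝ) ^ e * a ^ n := fun e n => by
    simp only [Pi.zero_apply]; positivity
  have hpos : ∀ N : ℕ, 0 < N → (0 : ℝ) < (N : ℝ) ^ (d + 1) * a ^ N := fun N hN => by
    have : (0 : ℝ) < N := by exact_mod_cast hN
    positivity
  obtain ⟨C, hC, N, hN, hup⟩ := exists_upper_bound (hg d) hw.isBigO
  obtain ⟨c, hc, N', hN', hlo⟩ := exists_lower_bound hw0 hw.symm.isBigO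
  constructor
  · set K := max (C / a) (s N / ((N : ℝ) ^ (d + 1) * a ^ N)) with hK
    have hK1 : C ≤ K * a := (div_le_iff₀ ha).1 (le_max_left _ _)
    have hK0 : 0 < K := (div_pos hC ha).trans_le (le_max_left _ _)
    refine isBigO_of_le (fun n => (hs0 n).le) (C := K) (le_of_supersolution ha.le hs
      ((div_le_iff₀ (hpos N hN)).1 (le_max_right _ _)) fun n hn => ?_)
    have h2 : (n : ℝ) ^ (d + 1) + (n : ℝ) ^ d ≤ ((n + 1 : ℕ) : ℝ) ^ (d + 1) := by
      have : (n : ℝ) ^ d ≤ ((n + 1 : ℕ) : ℝ) ^ d := by gcongr; simp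
      calc (n : ℝ) ^ (d + 1) + (n : ℝ) ^ d = (n : ℝ) ^ d * (n + 1) := by ring
        _ ≤ ((n + 1 : ℕ) : ℝ) ^ d * (n + 1) := by gcongr
        _ = _ := by push_cast; ring
    calc a * (K * ((n : ℝ) ^ (d + 1) * a ^ n)) + w n
        ≤ a * (K * ((n : ℝ) ^ (d + 1) * a ^ n)) + K * a * ((n : ℝ) ^ d * a ^ n) := by
          have := mul_le_mul_of_nonneg_right hK1 (hg d n)
          have := hup n hn
          linarith
      _ = K * (((n : ℝ) ^ (d + 1) + (n : ℝ) ^ d) * a ^ (n + 1)) := by ring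
      _ ≤ K * (((n + 1 : ℕ) : ℝ) ^ (d + 1) * a ^ (n + 1)) := by gcongr
  -- The first bound makes the subsolution inequality hold at each step; the second makes it start
  -- at `N'`.
  · set κ := min (c / (a * ((d + 1) * 2 ^ d))) (s N' / ((N' : ℝ) ^ (d + 1) * a ^ N')) with hκ
    have hκ0 : 0 < κ := lt_min (by positivity) (div_pos (hs0 _) (hpos _ hN'))
    have hκ1 : κ * (a * ((d + 1) * 2 ^ d)) ≤ c := (le_div_iff₀ (by positivity)).1 (min_le_left _ _)
    have key : ∀ n ≥ N', κ * ((n : ℝ) ^ (d + 1) * a ^ n) ≤ s n := by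
      refine ge_of_subsolution ha.le hs
        ((le_div_iff₀ (hpos N' hN')).1 (min_le_right _ _)) fun n hn => ?_
      have hn1 : (1 : ℝ) ≤ n := by exact_mod_cast (by omega : 1 ≤ n)
      have h2 : ((n + 1 : ℕ) : ℝ) ^ (d + 1) ≤
          (n : ℝ) ^ (d + 1) + (d + 1) * 2 ^ d * (n : ℝ) ^ d := by
        have h3 : ∀ e : ℕ, ((n : ℝ) + 1) ^ (e + 1) ≤ (n : ℝ) ^ (e + 1) + (e + 1) * (n + 1) ^ e := by
          intro e
          induction e with
          | zero => simp
          | succ e ih =>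
            have h4 : (n : ℝ) ^ (e + 1) ≤ (n + 1) ^ (e + 1) := by gcongr; simp
            have h5 := mul_le_mul_of_nonneg_right ih (by positivity : (0 : ℝ) ≤ n + 1)
            push_cast
            calc ((n : ℝ) + 1) ^ (e + 1 + 1) = (n + 1) ^ (e + 1) * (n + 1) := by ring
              _ ≤ ((n : ℝ) ^ (e + 1) + (e + 1) * (n + 1) ^ e) * (n + 1) := h5
              _ = (n : ℝ) ^ (e + 1 + 1) + (e + 1) * (n + 1) ^ (e + 1) + (n : ℝ) ^ (e + 1) := by ring
              _ ≤ _ := by linarith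
        have h6 : ((n : ℝ) + 1) ^ d ≤ 2 ^ d * (n : ℝ) ^ d := by
          rw [← mul_pow]
          gcongr
          linarith
        push_cast
        refine (h3 d).trans ?_
        rw [mul_assoc]
        gcongr
      calc κ * (((n + 1 : ℕ) : ℝ) ^ (d + 1) * a ^ (n + 1))
          ≤ κ * (((n : ℝ) ^ (d + 1) + (d + 1) * 2 ^ d * (n : ℝ) ^ d) * a ^ (n + 1)) := by gcongr
        _ = a * (κ * ((n : ℝ) ^ (d + 1) * a ^ n)) +
            κ * (a * ((d + 1) * 2 ^ d)) * ((n : ℝ) ^ d * a ^ n) := by ring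
        _ ≤ a * (κ * ((n : ℝ) ^ (d + 1) * a ^ n)) + c * ((n : ℝ) ^ d * a ^ n) := by gcongr
        _ ≤ _ := by linarith [hlo n hn]
    refine isBigO_of_le (hg _) (C := κ⁻¹) (N := N') fun n hn => ?_
    rw [← div_eq_inv_mul, le_div_iff₀' hκ0]
    exact key n hn

/-- The homogeneous solution dominates. A rate `μ` strictly between `b` and `a` absorbs the
polynomial factor, and subtracting `L * μ ^ n` from `K * a ^ n` absorbs the forcing. -/
theorem isTheta_of_recurrence_of_gt {a b : ℝ} {d : ℕ} (hb : 0 ≤ b) (hba : b < a)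
    (hs0 : ∀ n, 0 < s n) (hw0 : 0 ≤ w) (hs : ∀ n, s (n + 1) = a * s n + w n)
    (hw : w =O[atTop] fun n : ℕ => (n : ℝ) ^ d * b ^ n) :
    s =Θ[atTop] fun n : ℕ => a ^ n := by
  obtain ⟨μ, hbμ, hμa⟩ := exists_between hba
  have hμ : 0 < μ := hb.trans_lt hbμ
  have ha : 0 < a := hμ.trans hμa
  have hw' : w =O[atTop] fun n : ℕ => μ ^ n := by
    simpa using hw.trans (isBigO_pow_mul_pow_of_lt hb hbμ d 0)
  obtain ⟨C, hC, N, hN, hup⟩ := exists_upper_bound (fun n => (pow_pos hμ n).le) hw'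
  constructor
  · set L := C / (a - μ) with hL
    have hL0 : 0 < L := div_pos hC (by linarith)
    have hL1 : L * (a - μ) = C := div_mul_cancel₀ _ (by linarith)
    set K := (s N + L * μ ^ N) / a ^ N with hK
    have hK1 : K * a ^ N = s N + L * μ ^ N := div_mul_cancel₀ _ (by positivity)
    have key := le_of_supersolution (g := fun n => K * a ^ n - L * μ ^ n) ha.le hs
      (by simp [hK1]) (N := N) fun n hn => by
        have h1 := hup n hn
        rw [← hL1] at h1
        simp only [pow_succ]
        linarith
    refine isBigO_of_le (fun n => (hs0 n).le) (C := K) (N := N) fun n hn => (key n hn).trans ?_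
    have := pow_pos hμ n
    nlinarith
  · have key := ge_of_subsolution (g := fun n => s 0 * a ^ n) (N := 0) ha.le hs (by simp)
      fun n _ => by
        have := hw0 n
        simp only [Pi.zero_apply] at this
        rw [pow_succ]
        linarith
    refine isBigO_of_le (fun n => (pow_pos ha n).le) (C := (s 0)⁻¹) (N := 0) fun n hn => ?_
    rw [← div_eq_inv_mul, le_div_iff₀' (hs0 0)]
    exact key n hn

namespace HasGrowth

variable {S : Set ℝ}

/-- The class of sequences of polynomial-exponential order is stable under first-order linear
recurrences. -/
theorem of_recurrence {a : ℝ} (ha : 0 ≤ a) (haS : a ∈ S) (hs00 : 0 < s 0)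
    (hw0 : 0 ≤ w) (hs : ∀ n, s (n + 1) = a * s n + w n) (hw : HasGrowth S w) :
    HasGrowth S s := by
  obtain ⟨b, d, hb, hbS, hw⟩ := hw
  have hs0 : 0 ≤ s := by
    intro n
    induction n with
    | zero => exact hs00.le
    | succ n ih => rw [hs]; exact add_nonneg (mul_nonneg ha ih) (hw0 n)
  have hspos : 0 < a → ∀ n, 0 < s n := by
    intro ha' n
    induction n with
    | zero => exact hs00
    | succ n ih => rw [hs]; exact add_pos_of_pos_of_nonneg (mul_pos ha' ih) (hw0 n)
  rcases lt_trichotomy a b with h | rfl | h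
  · exact ⟨b, d, hb, hbS, isTheta_of_recurrence_of_lt ha h hs0 hw0 hs hw⟩
  · rcases ha.eq_or_lt with rfl | ha'
    -- With both rates zero there is no resonance: `w`, hence `s`, is eventually zero.
    · refine ⟨0, d, le_rfl, .inl rfl, ?_⟩
      have hw' : w =ᶠ[atTop] 0 := by
        exact isTheta_zero_right.1 (hw.trans (pow_mul_zero_pow_eventuallyEq d).isTheta)
      refine (EventuallyEq.trans ?_ (pow_mul_zero_pow_eventuallyEq d).symm).isTheta
      obtain ⟨N, hN⟩ := eventually_atTop.1 hw'
      filter_upwards [eventually_ge_atTop (N + 1)] with n hn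
      obtain ⟨k, rfl⟩ : ∃ k, n = k + 1 := ⟨n - 1, by omega⟩
      simp [hs, hN k (by omega)]
    · exact ⟨a, d + 1, ha, hbS, isTheta_of_recurrence_of_eq ha' (hspos ha') hw0 hs hw⟩
  · refine ⟨a, 0, ha, .inr haS, ?_⟩
    simpa using isTheta_of_recurrence_of_gt hb h (hspos (hb.trans_lt h)) hw0 hs hw.isBigO

end HasGrowth

/-! ### Perron–Frobenius for irreducible matrices -/

section Perron

open Matrix Relation

variable {κ : Type*} [Fintype κ]

/-- A nonnegative matrix all of whose indices reach each other spreads any nonzero nonnegative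
vector to a positive one. -/
theorem exists_iterate_pos [DecidableEq κ] {N : Matrix κ κ ℝ} (hN : ∀ i j, 0 ≤ N i j)
    (hirr : ∀ i j, ReflTransGen (fun i j => N i j ≠ 0) i j) {z : κ → ℝ} (hz : 0 ≤ z)
    (hz0 : z ≠ 0) : ∃ k : ℕ, ∀ l ≥ k, ∀ i, 0 < ((1 + N) ^ l *ᵥ z) i := by
  have hstep : ∀ (k : ℕ) (i : κ), ((1 + N) ^ (k + 1) *ᵥ z) i =
      ((1 + N) ^ k *ᵥ z) i + ∑ j, N i j * ((1 + N) ^ k *ᵥ z) j := by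
    intro k i
    rw [pow_succ', ← mulVec_mulVec, add_mulVec, one_mulVec]
    rfl
  have hnn : ∀ (k : ℕ) (i : κ), 0 ≤ ((1 + N) ^ k *ᵥ z) i := by
    intro k
    induction k with
    | zero => simpa using fun i => hz i
    | succ k ih =>
      intro i
      rw [hstep]
      exact add_nonneg (ih i) (Finset.sum_nonneg fun j _ => mul_nonneg (hN i j) (ih j))
  -- The identity in `1 + N` keeps positive entries positive, which removes any periodicity of `N`.
  have hmono : ∀ i, Monotone fun k : ℕ => ((1 + N) ^ k *ᵥ z) i := fun i =>
    monotone_nat_of_le_succ fun k => by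
      rw [hstep]
      exact le_add_of_nonneg_right
        (Finset.sum_nonneg fun j _ => mul_nonneg (hN i j) (hnn k j))
  obtain ⟨c, hc⟩ : ∃ c, z c ≠ 0 := by
    by_contra! h
    exact hz0 (funext h)
  have hex : ∀ i, ∃ k : ℕ, 0 < ((1 + N) ^ k *ᵥ z) i := by
    intro i
    induction hirr i c using ReflTransGen.head_induction_on with
    | refl => exact ⟨0, by simpa using lt_of_le_of_ne (hz c) (Ne.symm hc)⟩
    | @head i j hij _ ih =>
      obtain ⟨k, hk⟩ := ih
      refine ⟨k + 1, ?_⟩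
      rw [hstep]
      refine add_pos_of_nonneg_of_pos (hnn k i) ?_
      exact Finset.sum_pos' (fun j _ => mul_nonneg (hN i j) (hnn k j))
        ⟨j, Finset.mem_univ j, mul_pos (lt_of_le_of_ne (hN i j) (Ne.symm hij)) hk⟩
  choose k hk using hex
  refine ⟨Finset.univ.sup k, fun l hl i => (hk i).trans_le ?_⟩
  exact hmono i ((Finset.le_sup (Finset.mem_univ i)).trans hl)

/-- **Perron–Frobenius**: a nonnegative matrix all of whose indices reach each other has a
positive eigenvector, with a nonnegative eigenvalue. -/
theorem exists_pos_eigenvector [Nonempty κ] {N : Matrix κ κ ℝ}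
    (hN : ∀ i j, 0 ≤ N i j) (hirr : ∀ i j, ReflTransGen (fun i j => N i j ≠ 0) i j) :
    ∃ (ρ : ℝ) (x : κ → ℝ), 0 ≤ ρ ∧ (∀ i, 0 < x i) ∧ N *ᵥ x = ρ • x := by
  classical
  set B : ℝ := ∑ i, ∑ j, N i j with hB
  have hB0 : 0 ≤ B := Finset.sum_nonneg fun i _ => Finset.sum_nonneg fun j _ => hN i j
  -- Collatz–Wielandt: maximize `ρ` subject to `ρ • x ≤ N *ᵥ x` on the simplex. The cap `B` gives
  -- compactness.
  set K : Set ((κ → ℝ) × ℝ) := {p | p ∈ stdSimplex ℝ κ ×ˢ Set.Icc 0 B ∧ p.2 • p.1 ≤ N *ᵥ p.1}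
    with hK
  have hKc : IsCompact K := by
    refine ((isCompact_stdSimplex ℝ κ).prod isCompact_Icc).inter_right ?_
    exact isClosed_le (continuous_snd.smul continuous_fst)
      (Continuous.matrix_mulVec continuous_const continuous_fst)
  obtain ⟨c⟩ := ‹Nonempty κ›
  have hKne : K.Nonempty := by
    refine ⟨(Pi.single c 1, 0), ⟨single_mem_stdSimplex ℝ c, by simp [hB0]⟩, ?_⟩
    simp only [zero_smul]
    intro i
    simpa using hN i c
  obtain ⟨⟨x, ρ⟩, ⟨⟨hx, hρ⟩, hle⟩, hmax⟩ := hKc.exists_isMaxOn hKne continuous_snd.continuousOn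
  simp only at hx hρ hle
  have hx0 : x ≠ 0 := by
    rintro rfl
    simpa using hx.2
  -- a vector with a strict inequality contradicts maximality
  have hstrict : ∀ z : κ → ℝ, (∀ i, 0 < z i) → ¬ ∀ i, ρ * z i < (N *ᵥ z) i := by
    intro z hz hlt
    have hσ : 0 < ∑ i, z i := Finset.sum_pos (fun i _ => hz i) ⟨c, Finset.mem_univ c⟩
    obtain ⟨i₀, -, hi₀⟩ := Finset.exists_min_image Finset.univ (fun i => (N *ᵥ z) i / z i)
      ⟨c, Finset.mem_univ c⟩
    set r := (N *ᵥ z) i₀ / z i₀ with hr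
    have hρr : ρ < r := (lt_div_iff₀ (hz i₀)).2 (hlt i₀)
    have hrz : ∀ i, r * z i ≤ (N *ᵥ z) i := fun i =>
      (le_div_iff₀ (hz i)).1 (hi₀ i (Finset.mem_univ i))
    have hrB : r ≤ B := by
      have h1 : r * ∑ i, z i ≤ B * ∑ i, z i := by
        rw [Finset.mul_sum, hB, Finset.sum_mul]
        refine Finset.sum_le_sum fun i _ => (hrz i).trans ?_
        rw [Finset.sum_mul]
        refine Finset.sum_le_sum fun j _ => mul_le_mul_of_nonneg_left ?_ (hN i j)
        exact Finset.single_le_sum (fun k _ => (hz k).le) (Finset.mem_univ j)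
      exact le_of_mul_le_mul_right h1 hσ
    have hmem : ((∑ i, z i)⁻¹ • z, r) ∈ K := by
      refine ⟨⟨⟨fun i => ?_, ?_⟩, hρ.1.trans hρr.le, hrB⟩, fun i => ?_⟩
      · exact mul_nonneg (inv_nonneg.2 hσ.le) (hz i).le
      · simp only [Pi.smul_apply, smul_eq_mul, ← Finset.mul_sum]
        exact inv_mul_cancel₀ hσ.ne'
      · simp only [mulVec_smul, Pi.smul_apply, smul_eq_mul]
        calc r * ((∑ i, z i)⁻¹ * z i) = (∑ i, z i)⁻¹ * (r * z i) := by ring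
          _ ≤ _ := mul_le_mul_of_nonneg_left (hrz i) (inv_nonneg.2 hσ.le)
    exact absurd (hmax hmem) (not_le.2 hρr)
  -- A nonzero defect `N *ᵥ x - ρ • x` becomes positive everywhere under `(1 + N) ^ q`, which
  -- commutes with `N`; this contradicts maximality.
  have heig : N *ᵥ x = ρ • x := by
    by_contra hne
    obtain ⟨k, hk⟩ := exists_iterate_pos hN hirr (sub_nonneg.2 hle) (sub_ne_zero.2 hne)
    obtain ⟨l, hl⟩ := exists_iterate_pos hN hirr hx.1 hx0
    have hcomm : ∀ q : ℕ, N * (1 + N) ^ q = (1 + N) ^ q * N := fun q =>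
      (((Commute.one_left N).add_left (Commute.refl N)).pow_left q).symm.eq
    set q := max k l
    have hlt : ∀ i, ρ * ((1 + N) ^ q *ᵥ x) i < (N *ᵥ ((1 + N) ^ q *ᵥ x)) i := by
      intro i
      have := hk q (le_max_left _ _) i
      rw [mulVec_sub, mulVec_mulVec, ← hcomm, ← mulVec_mulVec, mulVec_smul] at this
      simpa using this
    exact hstrict _ (hl q (le_max_right _ _)) hlt
  obtain ⟨k, hk⟩ := exists_iterate_pos hN hirr hx.1 hx0
  refine ⟨ρ, x, hρ.1, fun i => ?_, heig⟩
  have h1 : ∀ k : ℕ, (1 + N) ^ k *ᵥ x = (1 + ρ) ^ k • x := by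
    intro k
    induction k with
    | zero => simp
    | succ k ih =>
      rw [pow_succ', ← mulVec_mulVec, ih, mulVec_smul, add_mulVec, one_mulVec, heig, pow_succ,
        mul_smul, add_smul, one_smul]
  have h2 := hk k le_rfl i
  rw [h1, Pi.smul_apply, smul_eq_mul] at h2
  exact (pos_iff_pos_of_mul_pos h2).1 (pow_pos (by linarith [hρ.1]) k)

end Perron

/-! ### Growth of row sums of a nonnegative matrix -/

section RowSums

open Matrix Relation

variable {ι : Type*} [Fintype ι] [DecidableEq ι] {M : Matrix ι ι ℝ}

/-- The index `j` is reached from `i` by a path of nonzero entries of `M`. -/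
def Matrix.Reaches (M : Matrix ι ι ℝ) (i j : ι) : Prop :=
  ReflTransGen (fun i j => M i j ≠ 0) i j

theorem Matrix.rowSum_pow_nonneg (hM : ∀ i j, 0 ≤ M i j) (i : ι) :
    0 ≤ fun n : ℕ => ∑ j, (M ^ n) i j :=
  fun n => Finset.sum_nonneg fun j _ => pow_apply_nonneg hM n i j

theorem Matrix.rowSum_pow_succ (M : Matrix ι ι ℝ) (i : ι) (n : ℕ) :
    ∑ j, (M ^ (n + 1)) i j = ∑ k, M i k * ∑ j, (M ^ n) k j := by
  simp_rw [pow_succ', mul_apply, Finset.mul_sum]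
  exact Finset.sum_comm

theorem Matrix.rowSum_pow_succ_le (hM : ∀ i j, 0 ≤ M i j) (i : ι) (n : ℕ) :
    ∑ j, (M ^ (n + 1)) i j ≤ (∑ k, ∑ l, M k l) * ∑ j, (M ^ n) i j := by
  simp_rw [pow_succ, mul_apply]
  rw [Finset.sum_comm, Finset.mul_sum]
  refine Finset.sum_le_sum fun j _ => ?_
  rw [← Finset.mul_sum, mul_comm]
  refine mul_le_mul_of_nonneg_right ?_ (pow_apply_nonneg hM n i j)
  exact Finset.single_le_sum (f := fun k => ∑ l, M k l)
    (fun k _ => Finset.sum_nonneg fun l _ => hM k l) (Finset.mem_univ j)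

/-- Row sums of powers of a nonnegative matrix dominate those of every reachable index. -/
theorem Matrix.Reaches.isBigO_rowSum (hM : ∀ i j, 0 ≤ M i j) {i j : ι} (h : M.Reaches i j) :
    (fun n : ℕ => ∑ k, (M ^ n) j k) =O[atTop] fun n : ℕ => ∑ k, (M ^ n) i k := by
  induction h with
  | refl => exact isBigO_refl _ _
  | @tail b c _ hbc ih =>
    refine IsBigO.trans ?_ ih
    have hpos : 0 < M b c := lt_of_le_of_ne (hM b c) (Ne.symm hbc)
    refine isBigO_of_le (rowSum_pow_nonneg hM c) (C := (M b c)⁻¹ * ∑ k, ∑ l, M k l) (N := 0)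
      fun n _ => ?_
    -- An edge from `b` to `c` gives `M b c * v c n ≤ v b (n + 1)`, and one more power costs at most
    -- a constant factor.
    rw [mul_assoc, ← div_eq_inv_mul, le_div_iff₀' hpos]
    refine le_trans ?_ (rowSum_pow_succ_le hM b n)
    rw [rowSum_pow_succ]
    exact Finset.single_le_sum (f := fun k => M b k * ∑ j, (M ^ n) k j)
      (fun k _ => mul_nonneg (hM b k) (rowSum_pow_nonneg hM k n)) (Finset.mem_univ c)

/-- The strongly connected component of an index `i` of a nonnegative matrix carries a left Perron
vector, whose eigenvalue is an eigenvalue of the whole matrix. -/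
theorem Matrix.exists_left_perron_vector (hM : ∀ i j, 0 ≤ M i j) (i : ι) :
    ∃ (ρ : ℝ) (y : ι → ℝ), 0 ≤ ρ ∧ M.charpoly.IsRoot ρ ∧
      (∀ c, M.Reaches i c → M.Reaches c i → 0 < y c ∧ (y ᵥ* M) c = ρ * y c) ∧
      ∀ c, ¬ (M.Reaches i c ∧ M.Reaches c i) → y c = 0 := by
  classical
  -- Levels: 0 is unreachable from `i`, 1 its component, 2 reachable without return. Nonzero entries
  -- never lower the level, so the component is a diagonal block of a triangular form.
  let b : ι → Fin 3 := fun c => if M.Reaches i c then if M.Reaches c i then 1 else 2 else 0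
  have hb1 : ∀ c, b c = 1 ↔ M.Reaches i c ∧ M.Reaches c i := by
    intro c
    by_cases h1 : M.Reaches i c <;> by_cases h2 : M.Reaches c i <;> simp [b, h1, h2]
  have hmono : ∀ c d, M c d ≠ 0 → b c ≤ b d := by
    intro c d hcd
    by_cases h1 : M.Reaches i c
    · have h2 : M.Reaches i d := ReflTransGen.tail h1 hcd
      by_cases h3 : M.Reaches d i
      · have h4 : M.Reaches c i := ReflTransGen.head hcd h3
        simp [b, h1, h2, h3, h4]
      · by_cases h4 : M.Reaches c i <;> simp [b, h1, h2, h3, h4]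
    · simp [b, h1]
  -- Transposed, so that a right eigenvector of `N` is a left one of the block.
  set N : Matrix {c // b c = 1} {c // b c = 1} ℝ := (M.toSquareBlock b 1)ᵀ with hN
  have : Nonempty {c // b c = 1} := ⟨⟨i, (hb1 i).2 ⟨ReflTransGen.refl, ReflTransGen.refl⟩⟩⟩
  have hpath : ∀ c d : ι, M.Reaches c d → ∀ (hc : b c = 1) (hd : b d = 1),
      ReflTransGen (fun c d : {c // b c = 1} => N c d ≠ 0) ⟨d, hd⟩ ⟨c, hc⟩ := by
    intro c d hcd
    induction hcd using ReflTransGen.head_induction_on with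
    | refl => exact fun _ _ => ReflTransGen.refl
    | @head c e hce hed ih =>
      intro hc hd
      have he : b e = 1 := (hb1 e).2
        ⟨ReflTransGen.tail ((hb1 c).1 hc).1 hce, hed.trans ((hb1 d).1 hd).2⟩
      exact ReflTransGen.tail (ih he hd) hce
  obtain ⟨ρ, x, hρ, hx, hNx⟩ := exists_pos_eigenvector (N := N) (fun c d => hM d c)
    fun c d => hpath d c (((hb1 d).1 d.2).2.trans ((hb1 c).1 c.2).1) d.2 c.2
  refine ⟨ρ, fun c => if h : b c = 1 then x ⟨c, h⟩ else 0, hρ, ?_, ?_, ?_⟩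
  · have hdet : ((scalar ι ρ - M).toSquareBlock b 1).det = 0 := by
      rw [← det_transpose]
      refine exists_mulVec_eq_zero_iff.1 ⟨x, ?_, ?_⟩
      · intro h
        exact (hx (Classical.arbitrary _)).ne' (congrFun h _)
      · have : ((scalar ι ρ - M).toSquareBlock b 1)ᵀ = scalar _ ρ - N := by
          ext c d
          simp [hN, toSquareBlock, toSquareBlockProp, scalar_apply, diagonal_apply, Subtype.ext_iff,
            eq_comm]
        rw [this, sub_mulVec, hNx]
        ext c
        simp [scalar_apply]
    rw [Polynomial.IsRoot.def, eval_charpoly]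
    have htri : (scalar ι ρ - M).BlockTriangular b := by
      intro c d hdc
      have h1 : M c d = 0 := by
        by_contra h
        exact (hmono c d h).not_gt hdc
      have h2 : c ≠ d := by
        rintro rfl
        exact lt_irrefl _ hdc
      simp [h1, h2, scalar_apply]
    rw [htri.det_fintype]
    exact Finset.prod_eq_zero (Finset.mem_univ 1) hdet
  · intro c h1 h2
    have hc := (hb1 c).2 ⟨h1, h2⟩
    refine ⟨by simpa [hc] using hx ⟨c, hc⟩, ?_⟩
    have := congrFun hNx ⟨c, hc⟩
    simp only [Pi.smul_apply, smul_eq_mul] at this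
    simp only [hc, dite_true, ← this, vecMul, mulVec, dotProduct]
    rw [← Finset.sum_filter_of_ne (p := fun c => b c = 1) fun d _ hd => by
        by_contra h
        exact hd (by simp [h]),
      Finset.sum_subtype (p := fun c => b c = 1) _ (by simp)]
    refine Finset.sum_congr rfl fun d _ => ?_
    simp [d.2, hN, toSquareBlock, toSquareBlockProp, mul_comm]
  · intro c hc
    simp [mt (hb1 c).1 hc]

/-- **Growth of row sums**: the row sums of the powers of a nonnegative real matrix are of order
`n ^ d * lam ^ n`, with no dependence on the residue of `n`. -/
theorem Matrix.hasGrowth_rowSum_pow (hM : ∀ i j, 0 ≤ M i j) (i : ι) :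
    HasGrowth {lam | M.charpoly.IsRoot lam} fun n : ℕ => ∑ j, (M ^ n) i j := by
  classical
  induction hcard : {j | M.Reaches i j}.ncard using Nat.strong_induction_on generalizing i with
  | _ m ih =>
  have hlower : ∀ j, M.Reaches i j → ¬ M.Reaches j i →
      HasGrowth {lam | M.charpoly.IsRoot lam} fun n : ℕ => ∑ k, (M ^ n) j k := by
    intro j hij hji
    refine ih _ ?_ j rfl
    rw [← hcard]
    exact Set.ncard_lt_ncard ⟨fun k hk => hij.trans hk, fun h => hji (h ReflTransGen.refl)⟩
  obtain ⟨ρ, y, hρ, hroot, hy, hy0⟩ := exists_left_perron_vector hM i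
  have hyn : ∀ c, 0 ≤ y c := fun c => by
    by_cases h : M.Reaches i c ∧ M.Reaches c i
    · exact (hy c h.1 h.2).1.le
    · exact (hy0 c h).ge
  set v : ι → ℕ → ℝ := fun j n => ∑ k, (M ^ n) j k with hv
  have hvn : ∀ j, 0 ≤ v j := fun j => rowSum_pow_nonneg hM j
  have hyi : 0 < y i := (hy i ReflTransGen.refl ReflTransGen.refl).1
  have hyMn : ∀ j, 0 ≤ (y ᵥ* M) j := fun j =>
    Finset.sum_nonneg fun c _ => mul_nonneg (hyn c) (hM c j)
  -- `D` also contains indices unreachable from `i`; their coefficients in `y ᵥ* M` vanish.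
  set D : Finset ι := Finset.univ.filter fun j => ¬ (M.Reaches i j ∧ M.Reaches j i) with hD
  have hw : HasGrowth {lam | M.charpoly.IsRoot lam}
      fun n : ℕ => ∑ j ∈ D, (y ᵥ* M) j * v j n := by
    refine HasGrowth.sum D (fun j n => (y ᵥ* M) j * v j n)
      (fun j _ n => mul_nonneg (hyMn j) (hvn j n)) fun j hj => ?_
    have hj : ¬ (M.Reaches i j ∧ M.Reaches j i) := by simpa [hD] using hj
    by_cases h0 : (y ᵥ* M) j = 0
    · simpa [h0] using HasGrowth.zero
    · obtain ⟨c, -, hc⟩ := Finset.exists_ne_zero_of_sum_ne_zero h0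
      have hic : M.Reaches i c := by
        by_contra h
        exact hc (by simp [hy0 c fun h' => h h'.1])
      have hij : M.Reaches i j := ReflTransGen.tail hic (right_ne_zero_of_mul hc)
      exact (hlower j hij fun h => hj ⟨hij, h⟩).const_mul _
  have hrec : ∀ n, ∑ c, y c * v c (n + 1) =
      ρ * ∑ c, y c * v c n + ∑ j ∈ D, (y ᵥ* M) j * v j n := by
    intro n
    have h1 : ∑ c, y c * v c (n + 1) = ∑ j, (y ᵥ* M) j * v j n := by
      simp only [hv, rowSum_pow_succ, vecMul, dotProduct, Finset.mul_sum, Finset.sum_mul]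
      rw [Finset.sum_comm]
      refine Finset.sum_congr rfl fun k _ => ?_
      rw [Finset.sum_comm]
      simp only [mul_assoc]
    rw [h1, ← Finset.sum_filter_add_sum_filter_not Finset.univ
      (fun j => M.Reaches i j ∧ M.Reaches j i), Finset.mul_sum]
    congr 1
    rw [Finset.sum_filter]
    refine Finset.sum_congr rfl fun j _ => ?_
    split_ifs with h
    · rw [(hy j h.1 h.2).2, mul_assoc]
    · simp [hy0 j h]
  have hs0 : 0 < ∑ c, y c * v c 0 := by
    refine Finset.sum_pos' (fun c _ => mul_nonneg (hyn c) (hvn c 0)) ⟨i, Finset.mem_univ i, ?_⟩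
    simpa [hv, one_apply] using hyi
  have hs : HasGrowth {lam | M.charpoly.IsRoot lam} fun n => ∑ c, y c * v c n :=
    HasGrowth.of_recurrence (s := fun n => ∑ c, y c * v c n) hρ hroot hs0
      (fun n => Finset.sum_nonneg fun j _ => mul_nonneg (hyMn j) (hvn j n)) hrec hw
  refine hs.congr_isTheta ⟨?_, ?_⟩
  · refine isBigO_of_le (hvn i) (C := (y i)⁻¹) (N := 0) fun n _ => ?_
    rw [← div_eq_inv_mul, le_div_iff₀' hyi]
    exact Finset.single_le_sum (f := fun c => y c * v c n)
      (fun c _ => mul_nonneg (hyn c) (hvn c n)) (Finset.mem_univ i)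
  · refine IsBigO.fun_sum fun c _ => ?_
    by_cases h : M.Reaches i c ∧ M.Reaches c i
    · exact IsBigO.const_mul_left (h.1.isBigO_rowSum hM) _
    · simpa [hy0 c h] using isBigO_zero (E' := ℝ) (v i) atTop

/-- The row sums of the powers of a nonnegative real matrix are of order `n ^ d * lam ^ n`, where
`lam` is an eigenvalue. -/
theorem Matrix.exists_isTheta_rowSum_pow (hM : ∀ i j, 0 ≤ M i j) (i : ι) :
    ∃ (lam : ℝ) (d : ℕ), 0 ≤ lam ∧ M.charpoly.IsRoot lam ∧
      (fun n : ℕ => ∑ j, (M ^ n) i j) =Θ[atTop] fun n : ℕ => (n : ℝ) ^ d * lam ^ n := by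
  obtain ⟨lam, d, hlam, h, hΘ⟩ := hasGrowth_rowSum_pow hM i
  refine ⟨lam, d, hlam, ?_, hΘ⟩
  -- If `lam = 0`, some power of `M` has a zero row, so `M` is singular and 0 is an eigenvalue.
  rcases h with rfl | h
  · have h0 : (fun n : ℕ => ∑ j, (M ^ n) i j) =ᶠ[atTop] 0 :=
      isTheta_zero_right.1 (hΘ.trans (pow_mul_zero_pow_eventuallyEq d).isTheta)
    obtain ⟨n, hn⟩ := h0.exists
    have hrow : ∀ j, (M ^ n) i j = 0 := fun j =>
      (Finset.sum_eq_zero_iff_of_nonneg fun j _ => pow_apply_nonneg hM n i j).1 hn j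
        (Finset.mem_univ j)
    have hdet : M.det = 0 := by
      have := det_eq_zero_of_row_eq_zero i hrow
      rw [det_pow] at this
      exact eq_zero_of_pow_eq_zero this
    rw [Polynomial.IsRoot.def, eval_charpoly, map_zero, zero_sub, det_neg, hdet, mul_zero]
  · exact h

end RowSums

/-! ### Passage to arithmetic progressions -/

/-- Along an arithmetic progression, a growth of order `n ^ d * lam ^ n` becomes one of order
`n ^ d * (lam ^ p) ^ n`. -/
theorem isTheta_comp_mul_add {u : ℕ → ℝ} {lam : ℝ} {d : ℕ}
    (hu : u =Θ[atTop] fun n : ℕ => (n : ℝ) ^ d * lam ^ n) {p : ℕ} (hp : 0 < p) (r : ℕ) :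
    (fun n => u (p * n + r)) =Θ[atTop] fun n : ℕ => (n : ℝ) ^ d * (lam ^ p) ^ n := by
  have htend : Tendsto (fun n : ℕ => p * n + r) atTop atTop :=
    tendsto_atTop_mono (fun n => (Nat.le_mul_of_pos_left n hp).trans (Nat.le_add_right _ _))
      tendsto_id
  have hcomp : (fun n => u (p * n + r)) =Θ[atTop]
      fun n : ℕ => ((p * n + r : ℕ) : ℝ) ^ d * lam ^ (p * n + r) :=
    ⟨hu.1.comp_tendsto htend, hu.2.comp_tendsto htend⟩
  refine hcomp.trans ?_
  rcases eq_or_ne lam 0 with rfl | hlam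
  · refine EventuallyEq.isTheta ?_
    filter_upwards [eventually_gt_atTop 0] with n hn
    simp [hp.ne', hn.ne']
  · have h1 : (fun n : ℕ => ((p * n + r : ℕ) : ℝ)) =Θ[atTop] fun n : ℕ => (n : ℝ) := by
      constructor
      · refine IsBigO.of_bound (p + r) ?_
        filter_upwards [eventually_ge_atTop 1] with n hn
        have hn' : (1 : ℝ) ≤ n := by exact_mod_cast hn
        rw [Real.norm_of_nonneg (by positivity), Real.norm_of_nonneg (by positivity)]
        push_cast
        nlinarith [(Nat.cast_nonneg r : (0 : ℝ) ≤ r)]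
      · refine IsBigO.of_bound 1 (Eventually.of_forall fun n => ?_)
        rw [Real.norm_of_nonneg (by positivity), Real.norm_of_nonneg (by positivity), one_mul]
        exact_mod_cast (Nat.le_mul_of_pos_left n hp).trans (Nat.le_add_right _ _)
    have h2 : (fun n : ℕ => lam ^ (p * n + r)) =Θ[atTop] fun n : ℕ => (lam ^ p) ^ n := by
      simp only [pow_add, pow_mul, mul_comm _ (lam ^ r)]
      exact (isTheta_const_mul_left (pow_ne_zero r hlam)).2 (isTheta_refl _ _)
    exact (h1.pow d).mul h2

/-! ### Natural matrices and complex spectra -/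

section NatMatrix

open Matrix

variable {ι : Type*} [Fintype ι] [DecidableEq ι]

theorem ofReal_mem_matSpec {M : Matrix ι ι ℕ} {lam : ℝ}
    (h : (M.map (fun x : ℕ => (x : ℝ))).charpoly.IsRoot lam) : (lam : ℂ) ∈ matSpec M := by
  have hmap : M.map (fun x : ℕ => (x : ℂ)) =
      (M.map (fun x : ℕ => (x : ℝ))).map Complex.ofRealHom := by
    ext i j
    simp
  rw [matSpec, Polynomial.mem_roots (charpoly_monic _).ne_zero, hmap, charpoly_map]
  exact h.map (f := Complex.ofRealHom)

theorem matSpec_transpose (M : Matrix ι ι ℕ) : matSpec Mᵀ = matSpec M := by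
  rw [matSpec, matSpec, transpose_map, charpoly_transpose]

theorem exists_isTheta_rowSum_natMatrix_pow (M : Matrix ι ι ℕ) (i : ι) :
    ∃ (lam : ℝ) (d : ℕ), 0 ≤ lam ∧ (lam : ℂ) ∈ matSpec M ∧
      (fun n : ℕ => ((∑ j, (M ^ n) i j : ℕ) : ℝ)) =Θ[atTop]
        fun n : ℕ => (n : ℝ) ^ d * lam ^ n := by
  obtain ⟨lam, d, h0, hroot, hΘ⟩ :=
    exists_isTheta_rowSum_pow (M := M.map (fun x : ℕ => (x : ℝ))) (fun i j => by simp) i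
  refine ⟨lam, d, h0, ofReal_mem_matSpec hroot, ?_⟩
  convert hΘ using 2 with n
  have hpow : M.map (fun x : ℕ => (x : ℝ)) ^ n = (M ^ n).map (fun x : ℕ => (x : ℝ)) :=
    (map_pow (Nat.castRingHom ℝ).mapMatrix M n).symm
  rw [hpow]
  simp

theorem exists_isTheta_colSum_natMatrix_pow (M : Matrix ι ι ℕ) (j : ι) :
    ∃ (lam : ℝ) (d : ℕ), 0 ≤ lam ∧ (lam : ℂ) ∈ matSpec M ∧
      (fun n : ℕ => ((∑ i, (M ^ n) i j : ℕ) : ℝ)) =Θ[atTop]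
        fun n : ℕ => (n : ℝ) ^ d * lam ^ n := by
  simpa only [matSpec_transpose, ← transpose_pow, transpose_apply] using
    exists_isTheta_rowSum_natMatrix_pow Mᵀ j

end NatMatrix

/-! ### Word lengths as column sums -/

section Morphism

variable {A : Type*} [Fintype A] [DecidableEq A] (f : FreeMonoid A →* FreeMonoid A)

theorem count_map_eq_sum (w : FreeMonoid A) (a : A) :
    (FreeMonoid.toList (f w)).count a =
      ∑ b, incidenceMatrix f a b * (FreeMonoid.toList w).count b := by
  induction w using FreeMonoid.inductionOn' with
  | one => simp
  | of_mul c w ih =>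
    simp only [map_mul, FreeMonoid.toList_mul, List.count_append, ih, FreeMonoid.toList_of,
      mul_add, Finset.sum_add_distrib]
    congr 1
    simp [List.count_singleton, incidenceMatrix]

theorem count_iterate_of (n : ℕ) (a b : A) :
    (FreeMonoid.toList (f^[n] (FreeMonoid.of b))).count a = (incidenceMatrix f ^ n) a b := by
  induction n generalizing a with
  | zero =>
    rw [Function.iterate_zero_apply, FreeMonoid.toList_of, pow_zero, Matrix.one_apply,
      List.count_singleton]
    simp only [beq_iff_eq, eq_comm (a := a)]
  | succ n ih =>
    rw [Function.iterate_succ_apply', count_map_eq_sum, pow_succ', Matrix.mul_apply]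
    simp only [ih]

theorem length_iterate_of (n : ℕ) (b : A) :
    (f^[n] (FreeMonoid.of b)).length = ∑ a, (incidenceMatrix f ^ n) a b := by
  simp only [← count_iterate_of]
  simpa [Multiset.coe_count, FreeMonoid.length] using (Multiset.sum_count_eq_card (s := Finset.univ)
    (m := (FreeMonoid.toList (f^[n] (FreeMonoid.of b)) : Multiset A)) (by simp)).symm

end Morphism

theorem mainTheorem4 :
    (∀ (m : ℕ) (M : Matrix (Fin m) (Fin m) ℕ),
      (∀ i : Fin m, ∃ (lam : ℝ) (d : ℕ), 0 ≤ lam ∧ (lam : ℂ) ∈ matSpec M ∧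
        ((fun n : ℕ => ((∑ j, (M ^ n) i j : ℕ) : ℝ)) =Θ[atTop]
          fun n : ℕ => (n : ℝ) ^ d * lam ^ n) ∧
        ∀ r < matPeriod M,
          (fun n : ℕ => ((∑ j, (M ^ (matPeriod M * n + r)) i j : ℕ) : ℝ)) =Θ[atTop]
            fun n : ℕ => (n : ℝ) ^ d * (lam ^ matPeriod M) ^ n) ∧
      (∀ j : Fin m, ∃ (lam : ℝ) (d : ℕ), 0 ≤ lam ∧ (lam : ℂ) ∈ matSpec M ∧
        ((fun n : ℕ => ((∑ i, (M ^ n) i j : ℕ) : ℝ)) =Θ[atTop]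
          fun n : ℕ => (n : ℝ) ^ d * lam ^ n) ∧
        ∀ r < matPeriod M,
          (fun n : ℕ => ((∑ i, (M ^ (matPeriod M * n + r)) i j : ℕ) : ℝ)) =Θ[atTop]
            fun n : ℕ => (n : ℝ) ^ d * (lam ^ matPeriod M) ^ n)) ∧
    (∀ (A : Type*) [Fintype A] [DecidableEq A] (f : FreeMonoid A →* FreeMonoid A) (a : A),
      ∃ (lam : ℝ) (d : ℕ), 0 ≤ lam ∧ (lam : ℂ) ∈ morphismSpec f ∧
        (fun n : ℕ => (((f^[n]) (FreeMonoid.of a)).length : ℝ)) =Θ[atTop]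
          fun n : ℕ => (n : ℝ) ^ d * lam ^ n) := by

  refine ⟨fun m M => ⟨fun i => ?_, fun j => ?_⟩, fun A _ _ f a => ?_⟩
  · obtain ⟨lam, d, h0, hmem, hΘ⟩ := exists_isTheta_rowSum_natMatrix_pow M i
    -- Only positivity of the period matters, and `r < matPeriod M` supplies it.
    exact ⟨lam, d, h0, hmem, hΘ, fun r hr => isTheta_comp_mul_add hΘ (Nat.zero_lt_of_lt hr) r⟩
  · obtain ⟨lam, d, h0, hmem, hΘ⟩ := exists_isTheta_colSum_natMatrix_pow M j
    exact ⟨lam, d, h0, hmem, hΘ, fun r hr => isTheta_comp_mul_add hΘ (Nat.zero_lt_of_lt hr) r⟩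
  · simp only [length_iterate_of]
    exact exists_isTheta_colSum_natMatrix_pow (incidenceMatrix f) a
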